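/- Let $H$ and $\mathcal H$ be Hilbert spaces with inner products $(\cdot,\cdot)$, $\langle\cdot,\cdot\rangle$ and norms $\|\cdot\|$, $|\cdot|$, and let $H$ be compactly (and injectively) embedded in $\mathcal H$, with $|u|\le c_0\|u\|$ for $u\in H$. Let $H_1,H_2$ be infinite-dimensional closed subspaces of $H$, and let $S_j$ be the orthogonal projector of $H$ onto $H_j$. Define $K_j:H_j\to H_j$ by $(K_ju,v)=\langle u,v\rangle$ for $u,v\in H_j$. Let $0<\lambda_1<\lambda_2<\cdots$ be the numbers whose reciprocals are the eigenvalues of $K_1$ (without repetition), let $m\ge 1$, let $X_m$ be the eigenspace of $K_1$ for $\lambda_m^{-1}$, and put $J_m=\dim X_m$. Write $S=S_2$ and $Tu=u-S_2u$. For $\varphi\in X_m$ let $\Psi_\varphi\in H_2$ be the solution of $(\Psi_\varphi,w)=(\varphi,w)-\lambda_m\langle\varphi,w\rangle$ for all $w\in H_2$. Let $\sigma>0$ be a constant in the inequality $|(S_1-S_2)u|^2\le\sigma\|u\|^2$, $u\in H$. Suppose that $H_2\subset H_1$. Then $\Psi_\varphi=0$ for all $\varphi\in X_m$. Moreover, there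 are positive constants $\sigma_0,c_1,c,C$, depending only on $m$, $\lambda_1,\ldots,\lambda_{m+1}$ and $c_0$, such that for $\sigma\le\sigma_0$ the following holds. (a) Every eigenvalue $\tau$ of the problem $$\frac1{\lambda_m}\Big((\Psi_\varphi,\Psi_\psi)-(T\varphi,T\psi)-(\Psi_\varphi,\psi)-(\varphi,\Psi_\psi)\Big)=\tau\,(S\varphi,S\psi)\quad\text{for all }\psi\in X_m,$$ with $0\ne\varphi\in X_m$, satisfies $|\tau|\le C\max_{\varphi\in X_m,\|\varphi\|=1}\|T\varphi\|^2$. (b) $K_2$ has, counting multiplicities, exactly $J_m$ eigenvalues $\mu_1^{-1},\ldots,\mu_{J_m}^{-1}$ in the interval $(\lambda_{m+1}^{-1}+c_1\sigma^{1/2},\ \lambda_{m-1}^{-1}-c_1\sigma^{1/2})$ (with right end $+\infty$ if $m=1$), these are also all its eigenvalues in $(\lambda_m^{-1}-c_1\sigma^{1/2},\ \lambda_m^{-1}+c_1\sigma^{1/2})$, and for $k=1,\ldots,J_m$ $$c\min_{\varphi\in X_m,\|\varphi\|=1}\|T\varphi\|^2\le|\mu_k^{-1}-\lambda_m^{-1}|\le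 C\max_{\varphi\in X_m,\|\varphi\|=1}\|T\varphi\|^2 .$$ -/

import Mathlib

universe u v w

noncomputable section

namespace EigPert

variable {𝕜 : Type w} [RCLike 𝕜]
variable {H : Type u} [NormedAddCommGroup H] [InnerProductSpace 𝕜 H]
variable {G : Type v} [NormedAddCommGroup G] [InnerProductSpace 𝕜 G]

/-- The operator `K : V → V` on a complete subspace `V` of `H` that is determined by
`(K x, y)_H = ⟨x, y⟩_G`, where `ι : H → G` is the embedding. -/
def gramOp [CompleteSpace G] (ι : H →L[𝕜] G) (V : Submodule 𝕜 H) [CompleteSpace V] :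
    V →L[𝕜] V :=
  ContinuousLinearMap.adjoint (ι ∘L V.subtypeL) ∘L (ι ∘L V.subtypeL)

theorem inner_gramOp [CompleteSpace G] (ι : H →L[𝕜] G) (V : Submodule 𝕜 H) [CompleteSpace V]
    (x y : V) : inner 𝕜 y (gramOp ι V x) = inner 𝕜 (ι y) (ι x) := by
  simp [gramOp, ContinuousLinearMap.adjoint_inner_right]

/-- The eigenspace of `gramOp ι V` for the real number `κ` (it is zero if `κ` is not an
eigenvalue). -/
def eigSpace [CompleteSpace G] (ι : H →L[𝕜] G) (V : Submodule 𝕜 H) [CompleteSpace V] (κ : ℝ) :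
    Submodule 𝕜 V :=
  Module.End.eigenspace (gramOp ι V : Module.End 𝕜 V) (κ : 𝕜)

/-- `lam 1 < lam 2 < ⋯` are positive and their reciprocals are all the eigenvalues of
`gramOp ι V`, without repetition. The value `lam 0` plays no role. -/
structure IsCharSeq [CompleteSpace G] (ι : H →L[𝕜] G) (V : Submodule 𝕜 H) [CompleteSpace V]
    (lam : ℕ → ℝ) : Prop where
  pos : ∀ j, 1 ≤ j → 0 < lam j
  strictMono : ∀ i j, 1 ≤ i → i < j → lam i < lam j
  hasEigenvalue_iff : ∀ κ : 𝕜, Module.End.HasEigenvalue (gramOp ι V : Module.End 𝕜 V) κ ↔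
    ∃ j, 1 ≤ j ∧ κ = (((lam j)⁻¹ : ℝ) : 𝕜)

/-- The numbers `(μ k)⁻¹`, `k : Fin n`, are exactly the eigenvalues of `gramOp ι V` in the set
`I`, each repeated according to its multiplicity. -/
structure EnumeratesEigenvalues [CompleteSpace G] (ι : H →L[𝕜] G) (V : Submodule 𝕜 H)
    [CompleteSpace V] (I : Set ℝ) {n : ℕ} (μ : Fin n → ℝ) : Prop where
  mem : ∀ k, (μ k)⁻¹ ∈ I
  rank_eq : ∀ κ ∈ I, Module.rank 𝕜 (eigSpace ι V κ) =
    ((Finset.univ.filter fun k => (μ k)⁻¹ = κ).card : Cardinal)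

/-- `σ` is a constant in the inequality `|(S₁ - S₂) x|² ≤ σ ‖x‖²`, `x ∈ H`, where `S₁`, `S₂` are
the orthogonal projectors of `H` onto `V₁`, `V₂`, and `|·|` is the norm of `G`. -/
def IsProximityConst (ι : H →L[𝕜] G) (V₁ V₂ : Submodule 𝕜 H) [CompleteSpace V₁]
    [CompleteSpace V₂] (σ : ℝ) : Prop :=
  ∀ x : H, ‖ι (V₁.starProjection x - V₂.starProjection x)‖ ^ 2 ≤ σ * ‖x‖ ^ 2

/-- `T x = x - S x`, with `S` the orthogonal projector of `H` onto `V`. -/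
def coProj (V : Submodule 𝕜 H) [CompleteSpace V] (x : H) : H := x - V.starProjection x

/-- The element `Ψ` of `V` with `(Ψ, y) = (x, y) - l ⟨x, y⟩` for all `y ∈ V`. -/
def psi [CompleteSpace G] (ι : H →L[𝕜] G) (V : Submodule 𝕜 H) [CompleteSpace V] (l : ℝ)
    (x : H) : V :=
  V.orthogonalProjectionOnto x - (l : 𝕜) • ContinuousLinearMap.adjoint (ι ∘L V.subtypeL) (ι x)

/-- `psi ι V l x` is the unique solution of its defining equation. The inner product of Mathlib is
linear in the second argument, so that the usual `(a, b)` is `inner 𝕜 b a`. -/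
theorem eq_psi_iff [CompleteSpace G] (ι : H →L[𝕜] G) (V : Submodule 𝕜 H) [CompleteSpace V]
    (l : ℝ) (x : H) (z : V) :
    z = psi ι V l x ↔
      ∀ y : V, inner 𝕜 (y : H) (z : H) =
        inner 𝕜 (y : H) x - (l : 𝕜) * inner 𝕜 (ι y) (ι x) := by
  have key : ∀ y : V, inner 𝕜 y (psi ι V l x) =
      inner 𝕜 (y : H) x - (l : 𝕜) * inner 𝕜 (ι y) (ι x) := by
    intro y
    simp [psi, inner_sub_right, inner_smul_right, ContinuousLinearMap.adjoint_inner_right]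
  constructor
  · rintro rfl y
    exact key y
  · intro h
    refine ext_inner_left 𝕜 fun y => ?_
    rw [key y, ← h y]
    rfl

/-- `τ` is an eigenvalue of the problem: find a nonzero `φ ∈ X` such that for all `ψ ∈ X`
`l⁻¹ ((Ψ_φ, Ψ_ψ) - (T φ, T ψ) - (Ψ_φ, ψ) - (φ, Ψ_ψ)) = τ (S φ, S ψ)`,
where `S`, `T`, `Ψ` are formed with the subspace `V₂`. -/
def IsReducedEigenvalue [CompleteSpace G] (ι : H →L[𝕜] G) {V₁ : Submodule 𝕜 H}
    (V₂ : Submodule 𝕜 H) [CompleteSpace V₂] (X : Submodule 𝕜 V₁) (l : ℝ) (τ : 𝕜) : Prop :=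
  ∃ φ ∈ X, φ ≠ 0 ∧ ∀ ψ ∈ X,
    ((l⁻¹ : ℝ) : 𝕜) *
        (inner 𝕜 (psi ι V₂ l (ψ : H) : H) (psi ι V₂ l (φ : H) : H)
          - inner 𝕜 (coProj V₂ (ψ : H)) (coProj V₂ (φ : H))
          - inner 𝕜 (ψ : H) (psi ι V₂ l (φ : H) : H)
          - inner 𝕜 (psi ι V₂ l (ψ : H) : H) (φ : H))
      = τ * inner 𝕜 (V₂.starProjection (ψ : H)) (V₂.starProjection (φ : H))

end EigPert

end

/-! Since $H_2\subset H_1$, the operator $B=K_2$ is the compression $SA$ of $A=K_1$ to $H_2$, and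
$\Psi_\varphi=0$ because $(\varphi,w)=\lambda_m\langle\varphi,w\rangle$ for every $w\in H_1$. Put
$\kappa=\lambda_m^{-1}$, $X=X_m$, $s=\sqrt\sigma$, and let $d$ be at most the distance from $\kappa$
to the other eigenvalues of $A$. On $H_1$ both $TA$ and $AT$ have norm at most $c_0s$
(`norm_coProj_gramOp_le`, `norm_gramOp_coProj_le`), so $A$ and $B$ agree on $H_2$ up to $c_0s$. The
spectral theorem, in the form of the lower bound `le_norm_sub_of_orthogonal`, then puts each
eigenvalue of $B$ near one of $A$. It also makes the projections between $X$ and the span $N$ of the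
eigenvectors of $B$ near $\kappa$ injective both ways, so $\dim N=\dim X$ (`finrank_eigSpan_eq`).
The quadratic bound is `exists_eigenvector_bounds`. If $Bx=\nu x$ and $x=\varphi+r$ with $\varphi\in
X$, $r\perp X$, then $q=Ax-\nu x=TAx=\kappa T\varphi+TAr$. The gap gives
$d\|r\|\lesssim\kappa\|T\varphi\|$, and pairing $q$ with $\varphi$ gives
$(\kappa-\nu)\|\varphi\|^2=\kappa\|T\varphi\|^2+(T\varphi,TAr)$, where the last term is at most a
third of the main one. -/

noncomputable section

namespace EigPert

open Module.End

/-! ### Spectral bounds for compact symmetric operators -/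

section CompactSymmetric

variable {𝕜 : Type w} [RCLike 𝕜]
variable {V : Type u} [NormedAddCommGroup V] [InnerProductSpace 𝕜 V]

/-- The span of the eigenspaces of `T` for the numbers `e i`. -/
def eigSpan (T : V →L[𝕜] V) {ι : Type*} (e : ι → 𝕜) : Submodule 𝕜 V :=
  ⨆ i, eigenspace (T : Module.End 𝕜 V) (e i)

theorem eigenspace_le_eigSpan (T : V →L[𝕜] V) {ι : Type*} (e : ι → 𝕜) (i : ι) :
    eigenspace (T : Module.End 𝕜 V) (e i) ≤ eigSpan T e :=
  le_iSup (fun i => eigenspace (T : Module.End 𝕜 V) (e i)) i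

/-- Pythagoras over the orthogonal eigenspaces. One decomposition serves every $\kappa$, so upper
and lower bounds for $T-\kappa$ follow by comparing terms. -/
theorem exists_norm_sq_eq_sum {T : V →L[𝕜] V} (hT : T.IsSymmetric) {ι : Type*} {e : ι → 𝕜}
    (he : Function.Injective e) {u : V} (hu : u ∈ eigSpan T e) :
    ∃ (s : Finset ι) (f : ι → V), ‖u‖ ^ 2 = ∑ i ∈ s, ‖f i‖ ^ 2 ∧
      ∀ κ : 𝕜, ‖T u - κ • u‖ ^ 2 = ∑ i ∈ s, ‖e i - κ‖ ^ 2 * ‖f i‖ ^ 2 := by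
  obtain ⟨f, hf, rfl⟩ := (Submodule.mem_iSup_iff_exists_finsupp _ _).1 hu
  have orth := (LinearMap.IsSymmetric.orthogonalFamily_eigenspaces hT).comp he
  refine ⟨f.support, f, ?_, fun κ => ?_⟩
  · exact orth.norm_sum (fun i => ⟨f i, hf i⟩) f.support
  · have h := orth.norm_sum (fun i => (e i - κ) • ⟨f i, hf i⟩) f.support
    simp only [map_smul] at h
    rw [show T (f.sum fun _ x => x) - κ • (f.sum fun _ x => x) =
      ∑ i ∈ f.support, (e i - κ) • f i from ?_]
    · refine h.trans (Finset.sum_congr rfl fun i _ => ?_)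
      rw [norm_smul, mul_pow]
      rfl
    · rw [Finsupp.sum, map_sum, Finset.smul_sum, ← Finset.sum_sub_distrib]
      refine Finset.sum_congr rfl fun i _ => ?_
      have : T (f i) = e i • f i := mem_eigenspace_iff.1 (hf i)
      rw [this, sub_smul]

theorem norm_sub_le_of_mem_eigSpan {T : V →L[𝕜] V} (hT : T.IsSymmetric) {ι : Type*} {e : ι → 𝕜}
    (he : Function.Injective e) {κ : 𝕜} {d : ℝ} (hd : 0 ≤ d) (hed : ∀ i, ‖e i - κ‖ ≤ d) {u : V}
    (hu : u ∈ eigSpan T e) : ‖T u - κ • u‖ ≤ d * ‖u‖ := by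
  obtain ⟨s, f, h₁, h₂⟩ := exists_norm_sq_eq_sum hT he hu
  refine le_of_sq_le_sq ?_ (by positivity)
  rw [h₂, mul_pow, h₁, Finset.mul_sum]
  gcongr with i
  exact hed i

theorem le_norm_sub_of_mem_eigSpan {T : V →L[𝕜] V} (hT : T.IsSymmetric) {ι : Type*} {e : ι → 𝕜}
    (he : Function.Injective e) {κ : 𝕜} {d : ℝ} (hd : 0 ≤ d) (hed : ∀ i, d ≤ ‖e i - κ‖) {u : V}
    (hu : u ∈ eigSpan T e) : d * ‖u‖ ≤ ‖T u - κ • u‖ := by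
  obtain ⟨s, f, h₁, h₂⟩ := exists_norm_sq_eq_sum hT he hu
  refine le_of_sq_le_sq ?_ (by positivity)
  rw [h₂, mul_pow, h₁, Finset.mul_sum]
  gcongr with i
  exact hed i

theorem exists_real_of_mem_eigenspace {T : V →L[𝕜] V} (hT : T.IsSymmetric) {ν : 𝕜} {x : V}
    (hx : x ∈ eigenspace (T : Module.End 𝕜 V) ν) (h0 : x ≠ 0) : ∃ t : ℝ, ν = (t : 𝕜) := by
  have := LinearMap.IsSymmetric.conj_eigenvalue_eq_self hT
    (hasEigenvalue_of_hasEigenvector (f := (T : Module.End 𝕜 V)) ⟨hx, h0⟩)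
  exact ⟨RCLike.re ν, (RCLike.conj_eq_iff_re.1 this).symm⟩

theorem inner_eq_zero_of_mem_eigenspace {T : V →L[𝕜] V} (hT : T.IsSymmetric) {ν ρ : 𝕜}
    (h : ν ≠ ρ) {x y : V} (hx : x ∈ eigenspace (T : Module.End 𝕜 V) ν)
    (hy : y ∈ eigenspace (T : Module.End 𝕜 V) ρ) : inner 𝕜 x y = 0 :=
  LinearMap.IsSymmetric.orthogonalFamily_eigenspaces hT h ⟨x, hx⟩ ⟨y, hy⟩

/-- A vector orthogonal to all eigenspaces within $d$ of $\kappa$ lies in the closed span of the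
remaining ones. The bound holds on their algebraic span and passes to the closure. -/
theorem le_norm_sub_of_orthogonal [CompleteSpace V] {T : V →L[𝕜] V} (hc : IsCompactOperator T)
    (hT : T.IsSymmetric) {κ d : ℝ} (hd : 0 ≤ d) {u : V}
    (hu : ∀ ν : ℝ, |ν - κ| < d → ∀ x ∈ eigenspace (T : Module.End 𝕜 V) (ν : 𝕜), inner 𝕜 x u = 0) :
    d * ‖u‖ ≤ ‖T u - (κ : 𝕜) • u‖ := by
  set M : Submodule 𝕜 V := eigSpan T (Subtype.val : {ν : 𝕜 // d ≤ ‖ν - κ‖} → 𝕜) with hM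
  have hMd : ∀ y ∈ M, d * ‖y‖ ≤ ‖T y - (κ : 𝕜) • y‖ := fun y hy =>
    le_norm_sub_of_mem_eigSpan hT Subtype.val_injective hd (fun i => i.2) hy
  have hMc : ∀ y ∈ M.topologicalClosure, d * ‖y‖ ≤ ‖T y - (κ : 𝕜) • y‖ := by
    have hcl : IsClosed {y : V | d * ‖y‖ ≤ ‖T y - (κ : 𝕜) • y‖} :=
      isClosed_le (by fun_prop) (by fun_prop)
    intro y hy
    exact closure_minimal (s := (M : Set V)) hMd hcl hy
  apply hMc
  set p := M.topologicalClosure.starProjection u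
  have hp : p ∈ M.topologicalClosure := Submodule.starProjection_apply_mem _ _
  -- The eigenspaces of a compact symmetric operator have dense span, so it suffices that $u-p$ is
  -- orthogonal to each: to the far ones by the choice of $p$, to the near ones because both $u$ and
  -- $p$ are.
  suffices u - p = 0 by rw [sub_eq_zero.1 this]; exact hp
  have hq : u - p ∈ M.topologicalClosureᗮ := Submodule.sub_starProjection_mem_orthogonal u
  have horth : ∀ ν : ℝ, |ν - κ| < d → ∀ x ∈ eigenspace (T : Module.End 𝕜 V) (ν : 𝕜),
      x ∈ Mᗮᗮᗮ := by
    intro ν hν x hx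
    rw [Submodule.triorthogonal_eq_orthogonal, hM, eigSpan, ← Submodule.iInf_orthogonal,
      Submodule.mem_iInf]
    rintro ⟨ρ, hρ⟩ y hy
    refine inner_eq_zero_of_mem_eigenspace hT ?_ hy hx
    rintro rfl
    rw [← RCLike.ofReal_sub, RCLike.norm_ofReal] at hρ
    exact absurd hρ (not_le.2 hν)
  have hbot := ContinuousLinearMap.orthogonalComplement_iSup_eigenspaces_eq_bot hc hT
  rw [← Submodule.mem_bot (R := 𝕜), ← hbot, ← Submodule.iInf_orthogonal, Submodule.mem_iInf]
  intro ν x hx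
  by_cases h0 : x = 0
  · simp [h0]
  by_cases hν : d ≤ ‖ν - κ‖
  · exact hq x (M.le_topologicalClosure
      (eigenspace_le_eigSpan T (Subtype.val : {ν : 𝕜 // d ≤ ‖ν - κ‖} → 𝕜) ⟨ν, hν⟩ hx))
  · obtain ⟨t, rfl⟩ := exists_real_of_mem_eigenspace hT hx h0
    rw [← RCLike.ofReal_sub, RCLike.norm_ofReal, not_le] at hν
    rw [inner_sub_right, hu t hν x hx, zero_sub, neg_eq_zero]
    rw [← Submodule.orthogonal_orthogonal_eq_closure] at hp
    exact (Submodule.mem_orthogonal' _ _).1 (horth t hν x hx) p hp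

/-- $N$ is invariant and finite-dimensional, so the restriction of $T$ to it can be diagonalized. An
eigenvector in $N$ with eigenvalue outside $I$ would be orthogonal to $N$, hence to itself. -/
theorem exists_enumeration {T : V →L[𝕜] V} (hT : T.IsSymmetric) (I : Set ℝ)
    (N : Submodule 𝕜 V) (hN : N = eigSpan T (fun ν : I => ((ν : ℝ) : 𝕜)))
    [FiniteDimensional 𝕜 N] {n : ℕ} (hn : Module.finrank 𝕜 N = n) :
    ∃ μ : Fin n → ℝ, (∀ k, (μ k)⁻¹ ∈ I) ∧ ∀ κ ∈ I,
      Module.rank 𝕜 (eigenspace (T : Module.End 𝕜 V) (κ : 𝕜)) =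
        ((Finset.univ.filter fun k => (μ k)⁻¹ = κ).card : Cardinal) := by
  have hinv : ∀ x ∈ N, (T : Module.End 𝕜 V) x ∈ N := by
    intro x hx
    rw [hN] at hx ⊢
    refine Submodule.iSup_induction _ (motive := fun x => (T : Module.End 𝕜 V) x ∈ eigSpan T _)
      hx ?_ (by simp) ?_
    · intro i y hy
      rw [mem_eigenspace_iff.1 hy]
      exact Submodule.smul_mem _ _ (eigenspace_le_eigSpan T _ i hy)
    · intro y z hy hz
      rw [map_add]
      exact Submodule.add_mem _ hy hz
  set R : N →ₗ[𝕜] N := (T : Module.End 𝕜 V).restrict hinv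
  have hR : R.IsSymmetric := LinearMap.IsSymmetric.restrict_invariant hT hinv
  have hRmem : ∀ (κ : 𝕜) (x : N), x ∈ eigenspace R κ ↔
      (x : V) ∈ eigenspace (T : Module.End 𝕜 V) κ := by
    intro κ x
    rw [mem_eigenspace_iff, mem_eigenspace_iff, Subtype.ext_iff]
    rfl
  refine ⟨fun k => (hR.eigenvalues hn k)⁻¹, fun k => ?_, fun κ hκ => ?_⟩
  · rw [inv_inv]
    by_contra hk
    obtain ⟨x, hx, hx0⟩ := (hR.hasEigenvalue_eigenvalues hn k).exists_hasEigenvector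
    apply hx0
    have hxT := (hRmem _ x).1 hx
    have hNorth : Nᗮ = ⨅ ν : I, (eigenspace (T : Module.End 𝕜 V) ((ν : ℝ) : 𝕜))ᗮ := by
      rw [hN, eigSpan, Submodule.iInf_orthogonal]
    have hself : (x : V) ∈ Nᗮ := by
      rw [hNorth, Submodule.mem_iInf]
      rintro ⟨ρ, hρ⟩ y hy
      refine inner_eq_zero_of_mem_eigenspace hT ?_ hy hxT
      intro h
      exact hk (RCLike.ofReal_injective h ▸ hρ)
    exact Subtype.ext (inner_self_eq_zero.1 (hself x x.2))
  · have hle : eigenspace (T : Module.End 𝕜 V) (κ : 𝕜) ≤ N := by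
      rw [hN]
      exact eigenspace_le_eigSpan T (fun ν : I => ((ν : ℝ) : 𝕜)) ⟨κ, hκ⟩
    have hcom : eigenspace R (κ : 𝕜) = (eigenspace (T : Module.End 𝕜 V) (κ : 𝕜)).comap N.subtype := by
      ext x
      exact hRmem _ x
    have heq : Module.rank 𝕜 (eigenspace R (κ : 𝕜)) =
        Module.rank 𝕜 (eigenspace (T : Module.End 𝕜 V) (κ : 𝕜)) := by
      rw [hcom]
      exact (Submodule.comapSubtypeEquivOfLe hle).rank_eq
    rw [← heq, ← Module.finrank_eq_rank, ← hR.card_filter_eigenvalues_eq hn]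
    simp only [inv_inv, RCLike.ofReal_inj]

end CompactSymmetric

/-! ### Projections and the compression of the Gram operator -/

section Compression

variable {𝕜 : Type w} [RCLike 𝕜]
variable {H : Type u} [NormedAddCommGroup H] [InnerProductSpace 𝕜 H]
variable {G : Type v} [NormedAddCommGroup G] [InnerProductSpace 𝕜 G]

section coProj

variable (V : Submodule 𝕜 H) [CompleteSpace V]

theorem coProj_add (x y : H) : coProj V (x + y) = coProj V x + coProj V y := by
  simp only [coProj, map_add]
  abel

theorem coProj_smul (a : 𝕜) (x : H) : coProj V (a • x) = a • coProj V x := by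
  simp only [coProj, map_smul, smul_sub]

theorem coProj_mem_orthogonal (x : H) : coProj V x ∈ Vᗮ :=
  Submodule.sub_starProjection_mem_orthogonal x

theorem coProj_coProj (x : H) : coProj V (coProj V x) = coProj V x := by
  rw [coProj, (Submodule.starProjection_apply_eq_zero_iff V).2 (coProj_mem_orthogonal V x), sub_zero]

theorem inner_coProj_coProj (x y : H) :
    inner 𝕜 (coProj V x) (coProj V y) = inner 𝕜 (coProj V x) y := by
  conv_lhs => rw [coProj.eq_def V y]
  rw [inner_sub_right, (Submodule.mem_orthogonal' V _).1 (coProj_mem_orthogonal V x) _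
    (Submodule.starProjection_apply_mem V y), sub_zero]

theorem inner_coProj_left (x y : H) :
    inner 𝕜 x (coProj V y) = inner 𝕜 (coProj V x) (coProj V y) := by
  rw [inner_coProj_coProj, ← inner_conj_symm, ← inner_coProj_coProj, inner_conj_symm,
    inner_coProj_coProj]

theorem norm_starProjection_sq (x : H) :
    ‖V.starProjection x‖ ^ 2 = ‖x‖ ^ 2 - ‖coProj V x‖ ^ 2 := by
  have h : V.starProjection x + coProj V x = x := by simp [coProj]
  have h₂ := norm_add_sq (𝕜 := 𝕜) (V.starProjection x) (coProj V x)
  rw [h, coProj_mem_orthogonal V x _ (Submodule.starProjection_apply_mem V x), map_zero] at h₂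
  linarith

theorem coProj_mem {V W : Submodule 𝕜 H} [CompleteSpace V] (hle : V ≤ W) {x : H} (hx : x ∈ W) :
    coProj V x ∈ W :=
  W.sub_mem hx (hle (Submodule.starProjection_apply_mem V x))

end coProj

theorem IsProximityConst.norm_le {ι : H →L[𝕜] G} {V₁ V₂ : Submodule 𝕜 H} [CompleteSpace V₁]
    [CompleteSpace V₂] {σ : ℝ} (hσ : 0 ≤ σ) (h : IsProximityConst ι V₁ V₂ σ) {x : H}
    (hx : x ∈ V₁) : ‖ι (coProj V₂ x)‖ ≤ √σ * ‖x‖ := by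
  have := h x
  rw [Submodule.starProjection_eq_self_iff.2 hx] at this
  refine le_of_sq_le_sq ?_ (by positivity)
  rwa [mul_pow, Real.sq_sqrt hσ]

variable [CompleteSpace G]

theorem inner_coe_gramOp (ι : H →L[𝕜] G) (V : Submodule 𝕜 H) [CompleteSpace V] (x : V) {y : H}
    (hy : y ∈ V) : inner 𝕜 y (gramOp ι V x : H) = inner 𝕜 (ι y) (ι x) :=
  inner_gramOp ι V x ⟨y, hy⟩

theorem isSymmetric_gramOp (ι : H →L[𝕜] G) (V : Submodule 𝕜 H) [CompleteSpace V] :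
    (gramOp ι V).IsSymmetric := by
  intro x y
  change inner 𝕜 (gramOp ι V x) y = inner 𝕜 x (gramOp ι V y)
  rw [inner_gramOp, ← inner_conj_symm, inner_gramOp, inner_conj_symm]

theorem isCompactOperator_gramOp {ι : H →L[𝕜] G} (hι : IsCompactOperator ι) (V : Submodule 𝕜 H)
    [CompleteSpace V] : IsCompactOperator (gramOp ι V) :=
  (hι.comp_clm V.subtypeL).clm_comp (ContinuousLinearMap.adjoint (ι ∘L V.subtypeL))

variable {ι : H →L[𝕜] G} {V₁ V₂ : Submodule 𝕜 H} [CompleteSpace V₁] [CompleteSpace V₂]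

theorem coe_gramOp_of_le (hle : V₂ ≤ V₁) (x : V₂) :
    (gramOp ι V₂ x : H) = V₂.starProjection (gramOp ι V₁ (Submodule.inclusion hle x) : H) := by
  refine (Submodule.eq_starProjection_of_mem_of_inner_eq_zero (gramOp ι V₂ x).2 fun y hy => ?_).symm
  rw [← inner_conj_symm, inner_sub_right, inner_coe_gramOp ι V₁ _ (hle hy),
    inner_coe_gramOp ι V₂ _ hy]
  simp

/-- An eigenvector of the operator on $V_1$ satisfies the weak eigenvalue equation against all of
$V_1$, hence against $V_2$, so the right side defining $\Psi_\varphi$ vanishes. -/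
theorem psi_eq_zero (hle : V₂ ≤ V₁) {l : ℝ} (hl : l ≠ 0) {φ : V₁}
    (hφ : φ ∈ eigSpace ι V₁ l⁻¹) : psi ι V₂ l (φ : H) = 0 := by
  symm
  rw [eq_psi_iff]
  intro y
  have h : gramOp ι V₁ φ = ((l⁻¹ : ℝ) : 𝕜) • φ := mem_eigenspace_iff.1 hφ
  rw [← inner_coe_gramOp ι V₁ φ (hle y.2), h]
  have : (l : 𝕜) ≠ 0 := by exact_mod_cast hl
  simp [inner_smul_right, this]

/-! ### Comparison of the two operators -/

section estimates

variable {s c₀ : ℝ}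

/-- For $z=TAx$ one has $\|z\|^2=(z,Ax)=\langle z,x\rangle\le|z||x|$, and $Tz=z$ gives $|z|\le
s\|z\|$. -/
theorem norm_coProj_gramOp_le (hle : V₂ ≤ V₁) (hc : ∀ x, ‖ι x‖ ≤ c₀ * ‖x‖) (hs0 : 0 ≤ s)
    (hs : ∀ x ∈ V₁, ‖ι (coProj V₂ x)‖ ≤ s * ‖x‖) (x : V₁) :
    ‖coProj V₂ (gramOp ι V₁ x : H)‖ ≤ c₀ * s * ‖x‖ := by
  set z := coProj V₂ (gramOp ι V₁ x : H) with hz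
  have hzV : z ∈ V₁ := coProj_mem hle (gramOp ι V₁ x).2
  have h₁ : inner 𝕜 z z = inner 𝕜 (ι z) (ι x) := by
    rw [← inner_coe_gramOp ι V₁ x hzV, hz, inner_coProj_coProj]
  have h₂ : ‖z‖ ^ 2 ≤ ‖ι z‖ * ‖ι x‖ := by
    rw [norm_sq_eq_re_inner (𝕜 := 𝕜), h₁]
    exact (RCLike.re_le_norm _).trans (norm_inner_le_norm _ _)
  have h₃ : ‖ι z‖ ≤ s * ‖z‖ := by
    have := hs z hzV
    rwa [hz, coProj_coProj, ← hz] at this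
  have h₄ : ‖ι z‖ * ‖ι x‖ ≤ (s * ‖z‖) * (c₀ * ‖x‖) :=
    mul_le_mul h₃ (hc x) (norm_nonneg _) (by positivity)
  rcases (norm_nonneg z).eq_or_lt with h0 | h0
  · rw [← h0]
    have := (norm_nonneg _).trans (hc x)
    have h5 : 0 ≤ s * (c₀ * ‖x‖) := mul_nonneg hs0 this
    exact h5.trans_eq (by ring)
  · refine le_of_mul_le_mul_left ?_ h0
    nlinarith

/-- The mirror estimate: $z=ATx$ has $\|z\|^2=\langle z,Tx\rangle\le c_0\|z\|\,s\|x\|$. -/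
theorem norm_gramOp_coProj_le (hle : V₂ ≤ V₁) (hc : ∀ x, ‖ι x‖ ≤ c₀ * ‖x‖) (hs0 : 0 ≤ s)
    (hc0 : 0 ≤ c₀) (hs : ∀ x ∈ V₁, ‖ι (coProj V₂ x)‖ ≤ s * ‖x‖) (x : V₁) :
    ‖gramOp ι V₁ ⟨coProj V₂ (x : H), coProj_mem hle x.2⟩‖ ≤ c₀ * s * ‖x‖ := by
  set y : V₁ := ⟨coProj V₂ (x : H), coProj_mem hle x.2⟩ with hy
  set z := gramOp ι V₁ y
  have h₂ : ‖z‖ ^ 2 ≤ ‖ι z‖ * ‖ι y‖ := by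
    rw [norm_sq_eq_re_inner (𝕜 := 𝕜), inner_gramOp]
    exact (RCLike.re_le_norm _).trans (norm_inner_le_norm _ _)
  have h₃ : ‖ι y‖ ≤ s * ‖x‖ := hs x x.2
  have h₄ : ‖ι z‖ * ‖ι y‖ ≤ (c₀ * ‖z‖) * (s * ‖x‖) :=
    mul_le_mul (hc z) h₃ (norm_nonneg _) (by positivity)
  rcases (norm_nonneg z).eq_or_lt with h0 | h0
  · rw [← h0]
    positivity
  · refine le_of_mul_le_mul_left ?_ h0
    nlinarith

/-- $\kappa T\varphi=TA\varphi$ has norm at most $c_0s\|\varphi\|$. This keeps $S$ injective on the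
eigenspace. -/
theorem norm_coProj_eigenvector_le (hle : V₂ ≤ V₁) (hc : ∀ x, ‖ι x‖ ≤ c₀ * ‖x‖) (hs0 : 0 ≤ s)
    (hs : ∀ x ∈ V₁, ‖ι (coProj V₂ x)‖ ≤ s * ‖x‖) {κ : ℝ} (hκ : 0 < κ) (hsκ : c₀ * s ≤ κ / 2)
    {φ : V₁} (hφ : φ ∈ eigSpace ι V₁ κ) : ‖coProj V₂ (φ : H)‖ ≤ ‖φ‖ / 2 := by
  have h := norm_coProj_gramOp_le hle hc hs0 hs φ
  rw [show gramOp ι V₁ φ = (κ : 𝕜) • φ from mem_eigenspace_iff.1 hφ, Submodule.coe_smul, coProj_smul,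
    norm_smul, RCLike.norm_ofReal, abs_of_pos hκ] at h
  have h₂ := mul_le_mul_of_nonneg_right hsκ (norm_nonneg φ)
  refine le_of_mul_le_mul_left ?_ hκ
  linarith

theorem gramOp_inclusion (hle : V₂ ≤ V₁) (x : V₂) :
    (gramOp ι V₁ (Submodule.inclusion hle x) : H) = gramOp ι V₂ x +
      coProj V₂ (gramOp ι V₁ (Submodule.inclusion hle x) : H) := by
  rw [coe_gramOp_of_le hle, coProj]
  abel

theorem norm_gramOp_inclusion_sub_le (hle : V₂ ≤ V₁) (hc : ∀ x, ‖ι x‖ ≤ c₀ * ‖x‖) (hs0 : 0 ≤ s)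
    (hs : ∀ x ∈ V₁, ‖ι (coProj V₂ x)‖ ≤ s * ‖x‖) (x : V₂) (ν : 𝕜) :
    ‖gramOp ι V₁ (Submodule.inclusion hle x) - ν • Submodule.inclusion hle x‖ ≤
      ‖gramOp ι V₂ x - ν • x‖ + c₀ * s * ‖x‖ := by
  have h := norm_coProj_gramOp_le hle hc hs0 hs (Submodule.inclusion hle x)
  have e : ((gramOp ι V₁ (Submodule.inclusion hle x) - ν • Submodule.inclusion hle x : V₁) : H) =
      ((gramOp ι V₂ x - ν • x : V₂) : H) +
        coProj V₂ (gramOp ι V₁ (Submodule.inclusion hle x) : H) := by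
    push_cast
    conv_lhs => rw [gramOp_inclusion hle]
    simp only [Submodule.coe_inclusion]
    abel
  rw [Submodule.coe_norm, e]
  exact (norm_add_le _ _).trans (add_le_add le_rfl h)

/-- Every eigenvalue of `gramOp ι V₂` is close to an eigenvalue of `gramOp ι V₁`. -/
theorem exists_eigenvalue_near (hι : IsCompactOperator ι) (hle : V₂ ≤ V₁)
    (hc : ∀ x, ‖ι x‖ ≤ c₀ * ‖x‖) (hs0 : 0 ≤ s)
    (hs : ∀ x ∈ V₁, ‖ι (coProj V₂ x)‖ ≤ s * ‖x‖) {D : ℝ} (hD : c₀ * s < D) (hD0 : 0 ≤ D) {ν : ℝ}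
    (hν : eigSpace ι V₂ ν ≠ ⊥) : ∃ ρ : ℝ, |ρ - ν| < D ∧ eigSpace ι V₁ ρ ≠ ⊥ := by
  by_contra! hcon
  obtain ⟨x, hx, hx0⟩ := Submodule.exists_mem_ne_zero_of_ne_bot hν
  have hx' : gramOp ι V₂ x = (ν : 𝕜) • x := mem_eigenspace_iff.1 hx
  -- Without eigenvalues of the larger operator within $D$ of $\nu$, the orthogonality condition is
  -- vacuous and $D\|x\|\le\|Ax-\nu x\|\le c_0s\|x\|$.
  have h₁ := le_norm_sub_of_orthogonal (isCompactOperator_gramOp hι V₁) (isSymmetric_gramOp ι V₁)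
    hD0 (κ := ν) (u := Submodule.inclusion hle x) (fun ρ hρ y hy => by
      have := hcon ρ hρ
      rw [eigSpace] at this
      rw [this, Submodule.mem_bot] at hy
      rw [hy, inner_zero_left])
  have h₂ := norm_gramOp_inclusion_sub_le hle hc hs0 hs x (ν : 𝕜)
  rw [hx', sub_self, norm_zero, zero_add] at h₂
  have h₃ : ‖Submodule.inclusion hle x‖ = ‖x‖ := rfl
  rw [h₃] at h₁
  have := norm_pos_iff.2 hx0
  nlinarith

/-- The deviation of a perturbed eigenvalue is comparable to `‖T φ‖²` for some eigenvector `φ`. -/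
theorem exists_eigenvector_bounds (hι : IsCompactOperator ι)
    (hle : V₂ ≤ V₁) (hc : ∀ x, ‖ι x‖ ≤ c₀ * ‖x‖) (hs0 : 0 ≤ s)
    (hs : ∀ x ∈ V₁, ‖ι (coProj V₂ x)‖ ≤ s * ‖x‖) {κ d : ℝ} (hκ : 0 < κ) (hd : 0 < d)
    (hgap : ∀ ρ : ℝ, |ρ - κ| < d → eigSpace ι V₁ ρ ≠ ⊥ → ρ = κ) (hsd : c₀ * s ≤ d / 8) {ν : ℝ}
    (hνκ : |ν - κ| ≤ d / 2) {x : V₂} (hx : x ∈ eigSpace ι V₂ ν) (hx0 : x ≠ 0) :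
    ∃ φ ∈ eigSpace ι V₁ κ, φ ≠ 0 ∧ κ / 2 * ‖coProj V₂ (φ : H)‖ ^ 2 ≤ |ν - κ| * ‖φ‖ ^ 2 ∧
      |ν - κ| * ‖φ‖ ^ 2 ≤ 2 * κ * ‖coProj V₂ (φ : H)‖ ^ 2 := by
  have hsymm := isSymmetric_gramOp ι V₁
  have hcomp := isCompactOperator_gramOp hι V₁
  have hκ0 : (κ : 𝕜) ≠ 0 := by exact_mod_cast hκ.ne'
  have hfin : FiniteDimensional 𝕜 (eigSpace ι V₁ κ) :=
    ContinuousLinearMap.finite_dimensional_eigenspace hcomp _ hκ0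
  set A := gramOp ι V₁ with hA
  set X := eigSpace ι V₁ κ with hX
  set y : V₁ := Submodule.inclusion hle x with hy
  set φ : V₁ := X.starProjection y with hφ
  have hφX : φ ∈ X := Submodule.starProjection_apply_mem X y
  set r : V₁ := y - φ with hr
  have hrX : r ∈ Xᗮ := Submodule.sub_starProjection_mem_orthogonal y
  have hyr : y = φ + r := by rw [hr]; abel
  have hAφ : A φ = (κ : 𝕜) • φ := mem_eigenspace_iff.1 hφX
  have hArX : A r ∈ Xᗮ := LinearMap.IsSymmetric.invariant_orthogonalComplement_eigenspace hsymm _ _ hrX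
  set q : V₁ := A y - (ν : 𝕜) • y with hq
  have hqH : (q : H) = coProj V₂ (A y : H) := by
    have e := gramOp_inclusion (ι := ι) hle x
    rw [show gramOp ι V₂ x = (ν : 𝕜) • x from mem_eigenspace_iff.1 hx] at e
    rw [hq, Submodule.coe_sub, sub_eq_iff_eq_add, add_comm]
    exact e
  have hqr : q = ((κ - ν : ℝ) : 𝕜) • φ + (A r - (ν : 𝕜) • r) := by
    rw [hq, hyr, map_add, hAφ, smul_add, RCLike.ofReal_sub, sub_smul]
    abel
  have horth : inner 𝕜 φ (A r - (ν : 𝕜) • r) = 0 :=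
    (Xᗮ.sub_mem hArX (Xᗮ.smul_mem _ hrX)) φ hφX
  -- The part of $q$ orthogonal to $X$ is $Ar-\nu r$, so it is no longer than $q$.
  have hqnorm : ‖A r - (ν : 𝕜) • r‖ ≤ ‖q‖ := by
    have := norm_add_sq (𝕜 := 𝕜) (((κ - ν : ℝ) : 𝕜) • φ) (A r - (ν : 𝕜) • r)
    rw [← hqr, inner_smul_left, horth, mul_zero, map_zero] at this
    refine le_of_sq_le_sq ?_ (norm_nonneg _)
    have := sq_nonneg ‖((κ - ν : ℝ) : 𝕜) • φ‖
    linarith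
  have hqQ : (q : H) = (κ : 𝕜) • coProj V₂ (φ : H) + coProj V₂ (A r : H) := by
    rw [hqH, hyr, map_add, hAφ, Submodule.coe_add, coProj_add, Submodule.coe_smul, coProj_smul]
  have hAr : ‖coProj V₂ (A r : H)‖ ≤ d / 8 * ‖r‖ :=
    (norm_coProj_gramOp_le hle hc hs0 hs r).trans (by gcongr)
  have hqle : ‖q‖ ≤ κ * ‖coProj V₂ (φ : H)‖ + d / 8 * ‖r‖ := by
    rw [Submodule.coe_norm, hqQ]
    refine (norm_add_le _ _).trans (add_le_add ?_ hAr)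
    rw [norm_smul, RCLike.norm_ofReal, abs_of_pos hκ]
  have hrle : d * ‖r‖ ≤ ‖A r - (κ : 𝕜) • r‖ := by
    refine le_norm_sub_of_orthogonal hcomp hsymm hd.le fun ρ hρ z hz => ?_
    by_cases h : eigSpace ι V₁ ρ = ⊥
    · rw [eigSpace] at h
      rw [h, Submodule.mem_bot] at hz
      rw [hz, inner_zero_left]
    · rw [hgap ρ hρ h] at hz
      exact hrX z hz
  have hrle₂ : ‖A r - (κ : 𝕜) • r‖ ≤ ‖q‖ + d / 2 * ‖r‖ := by
    have e : A r - (κ : 𝕜) • r = (A r - (ν : 𝕜) • r) + ((ν - κ : ℝ) : 𝕜) • r := by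
      rw [RCLike.ofReal_sub, sub_smul]
      abel
    rw [e]
    refine (norm_add_le _ _).trans (add_le_add hqnorm ?_)
    rw [norm_smul, RCLike.norm_ofReal]
    gcongr
  -- From $d\|r\|\le\|q\|+\frac d2\|r\|\le\kappa\|T\varphi\|+(\frac d8+\frac d2)\|r\|$. Together
  -- with `hAr` this gives $\|TAr\|\le\frac\kappa3\|T\varphi\|$.
  have hrQ : 3 * (d / 8 * ‖r‖) ≤ κ * ‖coProj V₂ (φ : H)‖ := by linarith
  set Q := ‖coProj V₂ (φ : H)‖ with hQ
  -- Both sides are $(\varphi,q)$: on the left by orthogonality of $\varphi$ to $Ar-\nu r$, on the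
  -- right because $q$ lies in the range of $T$, so that $(\varphi,q)=(T\varphi,q)$.
  have hid : (((κ - ν) * ‖φ‖ ^ 2 : ℝ) : 𝕜) = ((κ * Q ^ 2 : ℝ) : 𝕜) +
      inner 𝕜 (coProj V₂ (φ : H)) (coProj V₂ (A r : H)) := by
    have e₁ : inner 𝕜 φ q = (((κ - ν) * ‖φ‖ ^ 2 : ℝ) : 𝕜) := by
      rw [hqr, inner_add_right, horth, add_zero, inner_smul_right, inner_self_eq_norm_sq_to_K]
      push_cast
      ring
    rw [← e₁, Submodule.coe_inner, hqH, inner_coProj_left, ← hqH, hqQ, inner_add_right,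
      inner_smul_right, inner_self_eq_norm_sq_to_K]
    push_cast
    ring
  have hdiff : |(κ - ν) * ‖φ‖ ^ 2 - κ * Q ^ 2| ≤ κ / 3 * Q ^ 2 := by
    rw [← RCLike.norm_ofReal (K := 𝕜), RCLike.ofReal_sub, hid, add_sub_cancel_left]
    refine (norm_inner_le_norm _ _).trans ?_
    calc Q * ‖coProj V₂ (A r : H)‖ ≤ Q * (κ * Q / 3) := by
          gcongr
          linarith
      _ = κ / 3 * Q ^ 2 := by ring
  have habs : |ν - κ| * ‖φ‖ ^ 2 = |(κ - ν) * ‖φ‖ ^ 2| := by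
    rw [abs_mul, abs_sub_comm, abs_of_nonneg (sq_nonneg ‖φ‖)]
  have hκQ : 0 ≤ κ * Q ^ 2 := by positivity
  have hb := abs_le.1 hdiff
  refine ⟨φ, hφX, ?_, ?_, ?_⟩
  -- If $\varphi=0$, then `hrQ` forces $r=0$ and hence $x=0$.
  · intro h0
    have hQ0 : Q = 0 := by rw [hQ, h0]; simp [coProj]
    rw [hQ0, mul_zero] at hrQ
    have hr0 : ‖r‖ = 0 := le_antisymm (by nlinarith) (norm_nonneg _)
    apply hx0
    have : y = 0 := by rw [hyr, h0, norm_eq_zero.1 hr0, add_zero]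
    exact Submodule.inclusion_injective hle (by rw [← hy, this, map_zero])
  · rw [habs, abs_of_nonneg (by linarith)]
    linarith
  · rw [habs, abs_of_nonneg (by linarith)]
    linarith

/-- The eigenvalues of `gramOp ι V₂` near `κ` have the total multiplicity of the eigenvalue `κ` of
`gramOp ι V₁`. -/
theorem finrank_eigSpan_eq (hι : IsCompactOperator ι)
    (hle : V₂ ≤ V₁) (hc : ∀ x, ‖ι x‖ ≤ c₀ * ‖x‖) (hc0 : 0 < c₀) (hs0 : 0 < s)
    (hs : ∀ x ∈ V₁, ‖ι (coProj V₂ x)‖ ≤ s * ‖x‖) {κ d : ℝ} (hκ : 0 < κ) (hd : 0 < d)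
    (hgap : ∀ ρ : ℝ, |ρ - κ| < d → eigSpace ι V₁ ρ ≠ ⊥ → ρ = κ) (hsd : c₀ * s ≤ d / 8)
    (hsκ : c₀ * s ≤ κ / 2) (I : Set ℝ) (hI : ∀ ν, ν ∈ I ↔ |ν - κ| < 3 * (c₀ * s)) :
    FiniteDimensional 𝕜 (eigSpan (gramOp ι V₂) (fun ν : I => ((ν : ℝ) : 𝕜))) ∧
      Module.finrank 𝕜 (eigSpan (gramOp ι V₂) (fun ν : I => ((ν : ℝ) : 𝕜))) =
        Module.finrank 𝕜 (eigSpace ι V₁ κ) := by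
  have hcs : 0 < c₀ * s := by positivity
  have hsymm := isSymmetric_gramOp ι V₁
  have hcomp := isCompactOperator_gramOp hι V₁
  have hκ0 : (κ : 𝕜) ≠ 0 := by exact_mod_cast hκ.ne'
  have hfin : FiniteDimensional 𝕜 (eigSpace ι V₁ κ) :=
    ContinuousLinearMap.finite_dimensional_eigenspace hcomp _ hκ0
  set X := eigSpace ι V₁ κ with hX
  set N := eigSpan (gramOp ι V₂) (fun ν : I => ((ν : ℝ) : 𝕜)) with hN
  let f : N →ₗ[𝕜] X :=
    X.orthogonalProjectionOnto.toLinearMap ∘ₗ Submodule.inclusion hle ∘ₗ N.subtype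
  -- For $x\in N$ orthogonal to $X$: $d\|x\|\le\|Ax-\kappa x\|\le(3+1)c_0s\|x\|\le\frac d2\|x\|$.
  have hf : Function.Injective f := by
    rw [← LinearMap.ker_eq_bot, LinearMap.ker_eq_bot']
    intro x hx
    have hxX : Submodule.inclusion hle (x : V₂) ∈ Xᗮ :=
      Submodule.orthogonalProjectionOnto_eq_zero_iff.1 hx
    have h₁ : d * ‖x‖ ≤ _ := le_norm_sub_of_orthogonal hcomp hsymm hd.le (κ := κ)
      (u := Submodule.inclusion hle (x : V₂)) fun ρ hρ z hz => by
        by_cases h : eigSpace ι V₁ ρ = ⊥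
        · rw [eigSpace] at h
          rw [h, Submodule.mem_bot] at hz
          rw [hz, inner_zero_left]
        · rw [hgap ρ hρ h] at hz
          exact hxX z hz
    have h₂ := norm_gramOp_inclusion_sub_le hle hc hs0.le hs (x : V₂) (κ : 𝕜)
    have h₃ : ‖gramOp ι V₂ x - (κ : 𝕜) • (x : V₂)‖ ≤ 3 * (c₀ * s) * ‖x‖ :=
      norm_sub_le_of_mem_eigSpan (isSymmetric_gramOp ι V₂)
        (RCLike.ofReal_injective.comp Subtype.val_injective) (by positivity) (fun i => by
          rw [Function.comp_apply, ← RCLike.ofReal_sub, RCLike.norm_ofReal]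
          exact ((hI i).1 i.2).le) x.2
    rw [show ‖(x : V₂)‖ = ‖x‖ from rfl] at h₂
    by_contra hx0
    have := norm_pos_iff.2 hx0
    nlinarith
  have hNfin : FiniteDimensional 𝕜 N := FiniteDimensional.of_injective f hf
  refine ⟨hNfin, le_antisymm (LinearMap.finrank_le_finrank_of_injective hf) ?_⟩
  let g : X →ₗ[𝕜] N := N.orthogonalProjectionOnto.toLinearMap ∘ₗ
    V₂.orthogonalProjectionOnto.toLinearMap ∘ₗ V₁.subtype ∘ₗ X.subtype
  -- If $u=S\varphi\perp N$, then $3c_0s\|u\|\le\|Bu-\kappa u\|=\|SAT\varphi\|\le c_0s\|\varphi\|$.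
  -- Hence $\|\varphi\|\le\|u\|+\|T\varphi\|\le(\frac13+\frac12)\|\varphi\|$; the window radius
  -- $3c_0s$ makes this factor less than 1.
  refine LinearMap.finrank_le_finrank_of_injective (f := g) ?_
  rw [← LinearMap.ker_eq_bot, LinearMap.ker_eq_bot']
  intro φ hφ
  set u : V₂ := V₂.orthogonalProjectionOnto ((φ : V₁) : H) with hu
  have huN : u ∈ Nᗮ := Submodule.orthogonalProjectionOnto_eq_zero_iff.1 hφ
  have h₁ : 3 * (c₀ * s) * ‖u‖ ≤ _ := le_norm_sub_of_orthogonal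
    (isCompactOperator_gramOp hι V₂) (isSymmetric_gramOp ι V₂) (by positivity) (κ := κ) (u := u)
    fun ρ hρ z hz => huN z
      (eigenspace_le_eigSpan _ (fun ν : I => ((ν : ℝ) : 𝕜)) ⟨ρ, (hI ρ).2 hρ⟩ hz)
  set y : V₁ := ⟨coProj V₂ ((φ : V₁) : H), coProj_mem hle φ.1.2⟩ with hy
  have huy : Submodule.inclusion hle u = φ - y := by
    apply Subtype.ext
    change (u : H) = ((φ : V₁) : H) - (((φ : V₁) : H) - V₂.starProjection ((φ : V₁) : H))
    rw [sub_sub_cancel]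
    rfl
  have hAφ : gramOp ι V₁ φ = (κ : 𝕜) • (φ : V₁) := mem_eigenspace_iff.1 φ.2
  have h₂ : ‖gramOp ι V₂ u - (κ : 𝕜) • u‖ ≤ ‖gramOp ι V₁ y‖ := by
    have e : ((gramOp ι V₂ u - (κ : 𝕜) • u : V₂) : H) = -V₂.starProjection (gramOp ι V₁ y : H) := by
      rw [Submodule.coe_sub, coe_gramOp_of_le hle, huy, map_sub, hAφ, Submodule.coe_sub, map_sub,
        Submodule.coe_smul, Submodule.coe_smul, map_smul, hu, Submodule.starProjection_apply]
      abel
    rw [Submodule.coe_norm, e, norm_neg]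
    exact Submodule.norm_starProjection_apply_le V₂ _
  have h₃ := norm_gramOp_coProj_le hle hc hs0.le hc0.le hs (φ : V₁)
  have h₄ := norm_coProj_eigenvector_le hle hc hs0.le hs hκ hsκ φ.2
  have h₅ : ‖(φ : V₁)‖ ≤ ‖u‖ + ‖y‖ := by
    have : (φ : V₁) = Submodule.inclusion hle u + y := by rw [huy]; abel
    calc ‖(φ : V₁)‖ = ‖Submodule.inclusion hle u + y‖ := by rw [← this]
      _ ≤ _ := norm_add_le _ _
  have h₆ : ‖y‖ ≤ ‖(φ : V₁)‖ / 2 := h₄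
  by_contra hφ0
  have h₇ : 0 < ‖(φ : V₁)‖ := norm_pos_iff.2 (by simpa using hφ0)
  have h₈ : c₀ * s * (3 * ‖u‖) ≤ c₀ * s * ‖(φ : V₁)‖ := by
    refine le_trans ?_ (h₁.trans (h₂.trans h₃))
    linarith
  have := le_of_mul_le_mul_left h₈ hcs
  linarith

end estimates

end Compression

/-! ### Extremal values of $\|T\varphi\|^2$ and the perturbation theorem -/

section Perturbation

variable {𝕜 : Type w} [RCLike 𝕜]
variable {H : Type u} [NormedAddCommGroup H] [InnerProductSpace 𝕜 H]
variable {G : Type v} [NormedAddCommGroup G] [InnerProductSpace 𝕜 G] [CompleteSpace G]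
variable {ι : H →L[𝕜] G} {V₁ V₂ : Submodule 𝕜 H} [CompleteSpace V₁] [CompleteSpace V₂]

theorem isCompact_coProj_values {V : Submodule 𝕜 H} (V₂ : Submodule 𝕜 H) [CompleteSpace V₂]
    (X : Submodule 𝕜 V) [FiniteDimensional 𝕜 X] :
    IsCompact {t : ℝ | ∃ φ ∈ X, ‖φ‖ = 1 ∧ t = ‖coProj V₂ (φ : H)‖ ^ 2} := by
  have : ProperSpace X := FiniteDimensional.proper 𝕜 X
  have hcont : Continuous fun φ : X => ‖coProj V₂ ((φ : V) : H)‖ ^ 2 := by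
    unfold coProj
    fun_prop
  convert (isCompact_sphere (0 : X) 1).image hcont using 1
  ext t
  constructor
  · rintro ⟨φ, hφ, h1, rfl⟩
    exact ⟨⟨φ, hφ⟩, by simpa using h1, rfl⟩
  · rintro ⟨φ, h1, rfl⟩
    exact ⟨φ, φ.2, by simpa using h1, rfl⟩

theorem norm_coProj_sq_mem_values {V : Submodule 𝕜 H} (V₂ : Submodule 𝕜 H) [CompleteSpace V₂]
    {X : Submodule 𝕜 V} {φ : V} (hφ : φ ∈ X) (h0 : φ ≠ 0) :
    ‖coProj V₂ (φ : H)‖ ^ 2 / ‖φ‖ ^ 2 ∈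
      {t : ℝ | ∃ φ ∈ X, ‖φ‖ = 1 ∧ t = ‖coProj V₂ (φ : H)‖ ^ 2} := by
  refine ⟨((‖φ‖⁻¹ : ℝ) : 𝕜) • φ, X.smul_mem _ hφ, ?_, ?_⟩
  · rw [norm_smul, RCLike.norm_ofReal, abs_of_nonneg (by positivity),
      inv_mul_cancel₀ (norm_ne_zero_iff.2 h0)]
  · rw [Submodule.coe_smul, coProj_smul, norm_smul, RCLike.norm_ofReal, mul_pow, sq_abs, inv_pow]
    field

theorem nonempty_coProj_values {V : Submodule 𝕜 H} (V₂ : Submodule 𝕜 H) [CompleteSpace V₂]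
    {X : Submodule 𝕜 V} (hX : X ≠ ⊥) :
    {t : ℝ | ∃ φ ∈ X, ‖φ‖ = 1 ∧ t = ‖coProj V₂ (φ : H)‖ ^ 2}.Nonempty := by
  obtain ⟨φ, hφ, h0⟩ := Submodule.exists_mem_ne_zero_of_ne_bot hX
  exact ⟨_, norm_coProj_sq_mem_values V₂ hφ h0⟩

/-- With $\Psi=0$, testing with $\psi=\varphi$ gives $-l^{-1}\|T\varphi\|^2=\tau\|S\varphi\|^2$, and
$\|S\varphi\|^2\ge\frac34\|\varphi\|^2$. -/
theorem norm_reducedEigenvalue_le (hle : V₂ ≤ V₁) {l b : ℝ} (hl : 0 < l)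
    (hhalf : ∀ φ ∈ eigSpace ι V₁ l⁻¹, ‖coProj V₂ (φ : H)‖ ≤ ‖φ‖ / 2)
    (hb : b ∈ upperBounds {t : ℝ | ∃ φ ∈ eigSpace ι V₁ l⁻¹, ‖φ‖ = 1 ∧
      t = ‖coProj V₂ (φ : H)‖ ^ 2}) {τ : 𝕜}
    (hτ : IsReducedEigenvalue ι V₂ (eigSpace ι V₁ l⁻¹) l τ) : ‖τ‖ ≤ 2 * l⁻¹ * b := by
  obtain ⟨φ, hφ, h0, h⟩ := hτ
  have h₁ := h φ hφ
  rw [psi_eq_zero hle hl.ne' hφ] at h₁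
  simp only [Submodule.coe_zero, inner_zero_right, inner_zero_left, sub_zero, zero_sub] at h₁
  have h₂ := congrArg norm h₁
  rw [norm_mul, norm_mul, norm_neg, inner_self_eq_norm_sq_to_K, inner_self_eq_norm_sq_to_K,
    norm_pow, norm_pow, RCLike.norm_ofReal, RCLike.norm_ofReal, RCLike.norm_ofReal, sq_abs,
    sq_abs, norm_starProjection_sq, abs_of_pos (inv_pos.2 hl)] at h₂
  have hpos : 0 < ‖φ‖ := norm_pos_iff.2 h0
  have hT := hhalf φ hφ
  have hTb : ‖coProj V₂ (φ : H)‖ ^ 2 ≤ b * ‖φ‖ ^ 2 :=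
    (div_le_iff₀ (by positivity)).1 (hb (norm_coProj_sq_mem_values V₂ hφ h0))
  have hT2 : ‖coProj V₂ (φ : H)‖ ^ 2 ≤ ‖φ‖ ^ 2 / 4 := by
    have := pow_le_pow_left₀ (norm_nonneg _) hT 2
    linarith
  have hl' := inv_pos.2 hl
  have h₃ : ‖τ‖ * (‖φ‖ ^ 2 / 2) ≤ l⁻¹ * (b * ‖φ‖ ^ 2) := by
    rw [← Submodule.coe_norm] at h₂
    calc ‖τ‖ * (‖φ‖ ^ 2 / 2) ≤ ‖τ‖ * (‖φ‖ ^ 2 - ‖coProj V₂ (φ : H)‖ ^ 2) := by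
          gcongr
          nlinarith
      _ = l⁻¹ * ‖coProj V₂ (φ : H)‖ ^ 2 := h₂.symm
      _ ≤ _ := by gcongr
  refine le_of_mul_le_mul_right ?_ (show 0 < ‖φ‖ ^ 2 / 2 by positivity)
  linarith

theorem IsCharSeq.eigSpace_ne_bot_iff {lam : ℕ → ℝ} (h : IsCharSeq ι V₁ lam) (κ : ℝ) :
    eigSpace ι V₁ κ ≠ ⊥ ↔ ∃ j, 1 ≤ j ∧ κ = (lam j)⁻¹ := by
  rw [eigSpace]
  refine (h.hasEigenvalue_iff (κ : 𝕜)).trans ?_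
  simp only [RCLike.ofReal_inj]

theorem IsCharSeq.inv_le_inv {lam : ℕ → ℝ} (h : IsCharSeq ι V₁ lam) {i j : ℕ} (hi : 1 ≤ i)
    (hij : i ≤ j) : (lam j)⁻¹ ≤ (lam i)⁻¹ := by
  rcases hij.eq_or_lt with rfl | hij
  · rfl
  · exact inv_anti₀ (h.pos i hi) (h.strictMono i j hi hij).le

theorem IsCharSeq.inv_lt_inv {lam : ℕ → ℝ} (h : IsCharSeq ι V₁ lam) {i j : ℕ} (hi : 1 ≤ i)
    (hij : i < j) : (lam j)⁻¹ < (lam i)⁻¹ :=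
  inv_strictAnti₀ (h.pos i hi) (h.strictMono i j hi hij)

/-- The spectral perturbation estimates for a fixed spectral gap `d`. -/
theorem eigenvalue_estimates {m : ℕ} (hm : 1 ≤ m) {c₀ : ℝ} (hc₀ : 0 < c₀) {lam : ℕ → ℝ}
    (hι : IsCompactOperator ι) (hc : ∀ x, ‖ι x‖ ≤ c₀ * ‖x‖) (hlam : IsCharSeq ι V₁ lam)
    (hle : V₂ ≤ V₁) {d : ℝ} (hd : 0 < d) (hd₁ : d ≤ (lam m)⁻¹ - (lam (m + 1))⁻¹)
    (hd₂ : 2 ≤ m → d ≤ (lam (m - 1))⁻¹ - (lam m)⁻¹) {s : ℝ} (hs0 : 0 < s)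
    (hs : ∀ x ∈ V₁, ‖ι (coProj V₂ x)‖ ≤ s * ‖x‖) (hsd : c₀ * s ≤ d / 8)
    (hsκ : c₀ * s ≤ (lam m)⁻¹ / 2) :
    ∃ a b : ℝ,
      IsLeast {t : ℝ | ∃ φ ∈ eigSpace ι V₁ (lam m)⁻¹, ‖φ‖ = 1 ∧ t = ‖coProj V₂ (φ : H)‖ ^ 2} a ∧
      IsGreatest {t : ℝ | ∃ φ ∈ eigSpace ι V₁ (lam m)⁻¹,
        ‖φ‖ = 1 ∧ t = ‖coProj V₂ (φ : H)‖ ^ 2} b ∧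
      (∀ τ : 𝕜, IsReducedEigenvalue ι V₂ (eigSpace ι V₁ (lam m)⁻¹) (lam m) τ →
        ‖τ‖ ≤ 2 * (lam m)⁻¹ * b) ∧
      ∃ μ : Fin (Module.finrank 𝕜 (eigSpace ι V₁ (lam m)⁻¹)) → ℝ,
        EnumeratesEigenvalues ι V₂
          {κ : ℝ | (lam m)⁻¹ - 3 * c₀ * s < κ ∧ κ < (lam m)⁻¹ + 3 * c₀ * s} μ ∧
        EnumeratesEigenvalues ι V₂
          {κ : ℝ | (lam (m + 1))⁻¹ + 3 * c₀ * s < κ ∧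
            (2 ≤ m → κ < (lam (m - 1))⁻¹ - 3 * c₀ * s)} μ ∧
        ∀ k, (lam m)⁻¹ / 2 * a ≤ |(μ k)⁻¹ - (lam m)⁻¹| ∧
          |(μ k)⁻¹ - (lam m)⁻¹| ≤ 2 * (lam m)⁻¹ * b := by
  set κ := (lam m)⁻¹ with hκdef
  have hκ : 0 < κ := inv_pos.2 (hlam.pos m hm)
  have hκ0 : (κ : 𝕜) ≠ 0 := by exact_mod_cast hκ.ne'
  have hcs : 0 < c₀ * s := by positivity
  have hfin : FiniteDimensional 𝕜 (eigSpace ι V₁ κ) :=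
    ContinuousLinearMap.finite_dimensional_eigenspace (isCompactOperator_gramOp hι V₁) _ hκ0
  have hbot : eigSpace ι V₁ κ ≠ ⊥ := (hlam.eigSpace_ne_bot_iff κ).2 ⟨m, hm, rfl⟩
  have hgap : ∀ ρ : ℝ, |ρ - κ| < d → eigSpace ι V₁ ρ ≠ ⊥ → ρ = κ := by
    intro ρ hρ hne
    obtain ⟨j, hj, rfl⟩ := (hlam.eigSpace_ne_bot_iff ρ).1 hne
    have hρ' := abs_lt.1 hρ
    rcases lt_trichotomy j m with h | rfl | h
    · have h₁ := hlam.inv_le_inv hj (show j ≤ m - 1 by omega)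
      have h₂ := hd₂ (by omega)
      linarith
    · rfl
    · have h₁ := hlam.inv_le_inv (show 1 ≤ m + 1 by omega) (show m + 1 ≤ j by omega)
      linarith
  obtain ⟨a, ha⟩ := (isCompact_coProj_values V₂ (eigSpace ι V₁ κ)).exists_isLeast
    (nonempty_coProj_values V₂ hbot)
  obtain ⟨b, hb⟩ := (isCompact_coProj_values V₂ (eigSpace ι V₁ κ)).exists_isGreatest
    (nonempty_coProj_values V₂ hbot)
  set I : Set ℝ := {ν : ℝ | κ - 3 * c₀ * s < ν ∧ ν < κ + 3 * c₀ * s} with hIdef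
  have hI : ∀ ν, ν ∈ I ↔ |ν - κ| < 3 * (c₀ * s) := by
    intro ν
    rw [abs_lt, hIdef, Set.mem_ofPred_eq]
    constructor <;> rintro ⟨h₁, h₂⟩ <;> constructor <;> linarith
  obtain ⟨hNfin, hNrank⟩ := finrank_eigSpan_eq hι hle hc hc₀ hs0 hs hκ hd hgap hsd hsκ I hI
  obtain ⟨μ, hμI, hμ⟩ := exists_enumeration (isSymmetric_gramOp ι V₂) I _ rfl hNrank
  refine ⟨a, b, ha, hb, fun τ hτ => ?_, μ, ⟨hμI, hμ⟩, ⟨fun k => ?_, fun ν hν => ?_⟩, fun k => ?_⟩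
  · exact norm_reducedEigenvalue_le hle (hlam.pos m hm)
      (fun φ hφ => norm_coProj_eigenvector_le hle hc hs0.le hs hκ hsκ hφ) hb.2 hτ
  -- The small window lies in the large interval because $6c_0s\le\frac34d<d$.
  · obtain ⟨h₁, h₂⟩ := hμI k
    refine ⟨by linarith, fun h => ?_⟩
    have := hd₂ h
    linarith
  · by_cases hνI : ν ∈ I
    · exact hμ ν hνI
    · have hνbot : eigSpace ι V₂ ν = ⊥ := by
        by_contra hne
        obtain ⟨ρ, hρ, hρne⟩ := exists_eigenvalue_near hι hle hc hs0.le hs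
          (D := 3 * (c₀ * s)) (by linarith) (by positivity) hne
        obtain ⟨j, hj, rfl⟩ := (hlam.eigSpace_ne_bot_iff ρ).1 hρne
        have hρ' := abs_lt.1 hρ
        obtain ⟨h₁, h₂⟩ := hν
        rcases lt_trichotomy j m with h | rfl | h
        · have h₃ := hlam.inv_le_inv hj (show j ≤ m - 1 by omega)
          have h₄ := h₂ (by omega)
          linarith
        · exact hνI ((hI ν).2 (by rwa [abs_sub_comm]))
        · have h₃ := hlam.inv_le_inv (show 1 ≤ m + 1 by omega) (show m + 1 ≤ j by omega)
          linarith
      rw [hνbot, rank_bot, Finset.filter_false_of_mem fun k _ (h : (μ k)⁻¹ = ν) => hνI (h ▸ hμI k)]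
      simp
  · have hne : eigSpace ι V₂ (μ k)⁻¹ ≠ ⊥ := by
      intro h
      have h₁ := hμ _ (hμI k)
      change Module.rank 𝕜 (eigSpace ι V₂ (μ k)⁻¹) = _ at h₁
      rw [h, rank_bot, eq_comm, Nat.cast_eq_zero, Finset.card_eq_zero] at h₁
      exact Finset.notMem_empty k (h₁ ▸ Finset.mem_filter.2 ⟨Finset.mem_univ k, rfl⟩)
    obtain ⟨x, hx, hx0⟩ := Submodule.exists_mem_ne_zero_of_ne_bot hne
    have hk := (hI _).1 (hμI k)
    obtain ⟨φ, hφ, hφ0, h₁, h₂⟩ := exists_eigenvector_bounds hι hle hc hs0.le hs hκ hd hgap hsd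
      (ν := (μ k)⁻¹) (by linarith) hx hx0
    have hpos : 0 < ‖φ‖ ^ 2 := by
      have := norm_pos_iff.2 hφ0
      positivity
    have hmem := norm_coProj_sq_mem_values V₂ hφ hφ0
    have hal := (le_div_iff₀ hpos).1 (ha.2 hmem)
    have hbu := (div_le_iff₀ hpos).1 (hb.2 hmem)
    constructor <;> refine le_of_mul_le_mul_right ?_ hpos
    · refine le_trans ?_ h₁
      rw [mul_assoc]
      gcongr
    · refine h₂.trans ?_
      rw [mul_assoc (2 * κ)]
      gcongr

end Perturbation

end EigPert

end

/-! ### Uniform choice of the constants -/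

theorem corollary1 {𝕜 : Type w} [RCLike 𝕜]
    (m : ℕ) (hm : 1 ≤ m) (ell : Fin (m + 1) → ℝ) (c₀ : ℝ) (hc₀ : 0 < c₀) :
    ∃ σ₀ c₁ c C : ℝ, 0 < σ₀ ∧ 0 < c₁ ∧ 0 < c ∧ 0 < C ∧
      ∀ (H : Type u) [NormedAddCommGroup H] [InnerProductSpace 𝕜 H] [CompleteSpace H]
        (G : Type v) [NormedAddCommGroup G] [InnerProductSpace 𝕜 G] [CompleteSpace G]
        (ι : H →L[𝕜] G) (H₁ H₂ : Submodule 𝕜 H) [CompleteSpace H₁] [CompleteSpace H₂]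
        (lam : ℕ → ℝ),
        Function.Injective ι → IsCompactOperator ι → (∀ x, ‖ι x‖ ≤ c₀ * ‖x‖) →
        ¬ FiniteDimensional 𝕜 H₁ → ¬ FiniteDimensional 𝕜 H₂ →
        EigPert.IsCharSeq ι H₁ lam → (∀ i : Fin (m + 1), lam (i + 1) = ell i) →
        H₂ ≤ H₁ →
        (∀ φ ∈ EigPert.eigSpace ι H₁ (lam m)⁻¹, EigPert.psi ι H₂ (lam m) (φ : H) = 0) ∧
        ∀ σ : ℝ, 0 < σ → σ ≤ σ₀ → EigPert.IsProximityConst ι H₁ H₂ σ →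
          ∃ a b : ℝ,
            IsLeast {t : ℝ | ∃ φ ∈ EigPert.eigSpace ι H₁ (lam m)⁻¹,
              ‖φ‖ = 1 ∧ t = ‖EigPert.coProj H₂ (φ : H)‖ ^ 2} a ∧
            IsGreatest {t : ℝ | ∃ φ ∈ EigPert.eigSpace ι H₁ (lam m)⁻¹,
              ‖φ‖ = 1 ∧ t = ‖EigPert.coProj H₂ (φ : H)‖ ^ 2} b ∧
            (∀ τ : 𝕜, EigPert.IsReducedEigenvalue ι H₂ (EigPert.eigSpace ι H₁ (lam m)⁻¹)
              (lam m) τ → ‖τ‖ ≤ C * b) ∧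
            ∃ μ : Fin (Module.finrank 𝕜 (EigPert.eigSpace ι H₁ (lam m)⁻¹)) → ℝ,
              EigPert.EnumeratesEigenvalues ι H₂
                {κ : ℝ | (lam m)⁻¹ - c₁ * √σ < κ ∧ κ < (lam m)⁻¹ + c₁ * √σ} μ ∧
              EigPert.EnumeratesEigenvalues ι H₂
                {κ : ℝ | (lam (m + 1))⁻¹ + c₁ * √σ < κ ∧
                  (2 ≤ m → κ < (lam (m - 1))⁻¹ - c₁ * √σ)} μ ∧
              ∀ k, c * a ≤ |(μ k)⁻¹ - (lam m)⁻¹| ∧ |(μ k)⁻¹ - (lam m)⁻¹| ≤ C * b := by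
  -- `ell` is indexed from 0, so index $m-1$ carries $\lambda_m$. For $m=1$ there is no upper
  -- neighbour, and the 1 in $d$ is an arbitrary positive filler.
  set κ : ℝ := (ell ⟨m - 1, by omega⟩)⁻¹ with hκdef
  set d : ℝ := min (κ - (ell ⟨m, by omega⟩)⁻¹)
    (if 2 ≤ m then (ell ⟨m - 2, by omega⟩)⁻¹ - κ else 1) with hddef
  by_cases hpos : 0 < κ ∧ 0 < d
  · obtain ⟨hκ, hd⟩ := hpos
    -- $\sigma_0$ is chosen so that $\sigma\le\sigma_0$ means $c_0\sqrt\sigma\le\min(\kappa/2,d/8)$.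
    refine ⟨(min (κ / 2) (d / 8) / c₀) ^ 2, 3 * c₀, κ / 2, 2 * κ, by positivity, by positivity,
      by positivity, by positivity, ?_⟩
    intro H _ _ _ G _ _ _ ι H₁ H₂ _ _ lam _ hι hc _ _ hlam hell hle
    have e₁ : (lam m)⁻¹ = κ := by
      rw [hκdef, ← hell ⟨m - 1, by omega⟩]
      simp only [Nat.sub_add_cancel hm]
    have e₂ : lam (m + 1) = ell ⟨m, by omega⟩ := hell ⟨m, by omega⟩
    refine ⟨fun φ hφ => EigPert.psi_eq_zero hle (hlam.pos m hm).ne' hφ, fun σ hσ hσ₀ hprox => ?_⟩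
    have hs : c₀ * √σ ≤ min (κ / 2) (d / 8) := by
      rw [mul_comm, ← le_div_iff₀ hc₀]
      exact Real.sqrt_le_iff.2 ⟨by positivity, hσ₀⟩
    have := EigPert.eigenvalue_estimates hm hc₀ hι hc hlam hle hd
      (by rw [e₁, e₂]; exact min_le_left _ _)
      (fun h => by
        have e₃ : lam (m - 1) = ell ⟨m - 2, by omega⟩ := by
          rw [← hell ⟨m - 2, by omega⟩]
          congr 1
          simp only
          omega
        rw [e₁, e₃]
        exact (min_le_right _ _).trans_eq (if_pos h))
      (Real.sqrt_pos.2 hσ) (fun x hx => hprox.norm_le hσ.le hx)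
      (hs.trans (min_le_right _ _)) (by rw [e₁]; exact hs.trans (min_le_left _ _))
    rwa [← e₁]
  -- Here `ell` cannot come from any `IsCharSeq`, which would make $\kappa$ and $d$ positive; the
  -- constants are irrelevant.
  · refine ⟨1, 1, 1, 1, one_pos, one_pos, one_pos, one_pos, ?_⟩
    intro H _ _ _ G _ _ _ ι H₁ H₂ _ _ lam _ hι hc _ _ hlam hell hle
    refine absurd ⟨?_, ?_⟩ hpos
    · rw [hκdef, ← hell]
      exact inv_pos.2 (hlam.pos _ (by simp))
    · refine lt_min ?_ ?_
      · rw [hκdef, ← hell, ← hell, sub_pos]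
        exact hlam.inv_lt_inv (by simp) (by simp only; omega)
      · split_ifs with h
        · rw [hκdef, ← hell, ← hell, sub_pos]
          exact hlam.inv_lt_inv (by simp) (by simp only; omega)
        · exact one_pos
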